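/- **Setting.** Let $M$ be a smooth 2-dimensional manifold. A rank 1 point-affine distribution $\mathcal F$ on $M$ consists of a smooth vector field $v_0$ (the drift) and, for every $x\in M$, an affine line $\mathcal F_x\subset T_xM$ containing $v_0(x)$, such that near every point $\mathcal F_x=v_0(x)+\operatorname{span}(v(x))$ for some smooth nowhere vanishing local vector field $v$. It is *strictly affine* if no $\mathcal F_x$ is a linear subspace of $T_xM$ (i.e. $0\notin\mathcal F_x$). It is *of constant type* if the rank of the span of the direction of $\mathcal F_x$ and the values at $x$ of the Lie brackets of local smooth sections of $\mathcal F$ does not depend on $x$ (equivalently, for local $v$ as above, $[v_0,v]$ is tangent to $\operatorname{span}(v)$ either at every point or at no point of $M$). A *positive definite quadratic cost functional* on $\mathcal F$ is a function $Q:\mathcal F\to\mathbb R$ that near every point has the form $Q(v_0(x)+u\,v(x))=g(x)u^2$ with $v$ as above and $g>0$ smooth. A *local point-affine isometry* between two such structures is a smooth diffeomorphism between open subsets whose derivative maps drift to drift and affine lines onto affine lines, and which preserves the cost functionals. The structure $(\mathcal F,Q)$ is *homogeneous* if for all $p,q\in M$ there is a local point-affine isometry of $(\mathcal F,Q)$ to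 itself, defined near $p$, that maps $p$ to $q$. **Theorem 2.2.** Let $\mathcal F$ be a rank 1, strictly affine point-affine distribution of constant type on a 2-dimensional manifold $M$, equipped with a positive definite quadratic cost functional $Q$. If $(\mathcal F,Q)$ is homogeneous, then there is one structure on an open subset $\Omega$ of $\mathbb R^2$, of the form $$\text{drift } v_1,\qquad \mathcal F=v_1+\operatorname{span}(v_2),\qquad Q(v_1+uv_2)=\tfrac12\,G(x)\,u^2,$$ such that every point of $M$ has a neighbourhood that is mapped onto an open subset of $\Omega$ by a local point-affine isometry to this structure, where $(v_1,v_2,G)$ and $\Omega$ are one of the following: (1.1) $v_1=\dfrac{\partial}{\partial x^1}$, $\;v_2=\dfrac{\partial}{\partial x^2}$, $\;G(x)=e^{2c_1x^1}$, on $\Omega=\mathbb R^2$, for some constant $c_1\in\mathbb R$; (1.2) $v_1=x^2\left(\dfrac{\partial}{\partial x^1}+j_0\dfrac{\partial}{\partial x^2}\right)$, $\;v_2=x^2\dfrac{\partial}{\partial x^2}$, $\;G(x)=g_0$, on $\Omega=\{x^2\neq0\}$, for some constants $j_0\in\mathbb R$ and $g_0>0$. -/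

import Mathlib

open Set Topology Manifold
open scoped ContDiff

/-- The data of a point-affine distribution on `M`: an affine subspace `F_x` of each tangent space,
and a distinguished (drift) vector in each tangent space. That the drift lies in `F_x`, smoothness
and the rank are stated in `PointAffineDistribution.IsRankOne`. -/
structure PointAffineDistribution {E : Type*} [NormedAddCommGroup E] [NormedSpace ℝ E]
    {H : Type*} [TopologicalSpace H] (I : ModelWithCorners ℝ E H)
    (M : Type*) [TopologicalSpace M] [ChartedSpace H M] where
  /-- The affine subspace `F_x` of `T_x M`. -/
  fiber : (x : M) → AffineSubspace ℝ (TangentSpace I x)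
  /-- The distinguished drift vector at `x`. -/
  drift : (x : M) → TangentSpace I x

namespace PointAffineDistribution

variable {E : Type*} [NormedAddCommGroup E] [NormedSpace ℝ E]
  {H : Type*} [TopologicalSpace H] {I : ModelWithCorners ℝ E H}
  {M : Type*} [TopologicalSpace M] [ChartedSpace H M]
  {E' : Type*} [NormedAddCommGroup E'] [NormedSpace ℝ E']
  {H' : Type*} [TopologicalSpace H'] {I' : ModelWithCorners ℝ E' H'}
  {M' : Type*} [TopologicalSpace M'] [ChartedSpace H' M']

/-- A cost functional is a function `Q : F → ℝ`. -/
def Cost (F : PointAffineDistribution I M) : Type _ :=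
  (x : M) → F.fiber x → ℝ

/-- The point-affine distribution `v₁ + span v₂`, with drift `v₁`. -/
noncomputable def ofFrame (v₁ v₂ : (x : M) → TangentSpace I x) : PointAffineDistribution I M where
  fiber x := AffineSubspace.mk' (v₁ x) (Submodule.span ℝ {v₂ x})
  drift := v₁

theorem exists_coeff {v₁ v₂ : (x : M) → TangentSpace I x} {x : M}
    (w : (ofFrame v₁ v₂).fiber x) :
    ∃ u : ℝ, (w : TangentSpace I x) = v₁ x + u • v₂ x := by
  obtain ⟨w, hw⟩ := w
  have h : w -ᵥ v₁ x ∈ Submodule.span ℝ {v₂ x} := hw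
  obtain ⟨u, hu⟩ := Submodule.mem_span_singleton.1 h
  refine ⟨u, ?_⟩
  rw [hu, vsub_eq_sub]
  exact (add_sub_cancel (v₁ x) w).symm

/-- The cost `Q (v₁ + u v₂) = (1 / 2) G u ^ 2` on `v₁ + span v₂`; the coefficient `u` is unique
wherever `v₂` does not vanish. -/
noncomputable def frameCost (v₁ v₂ : (x : M) → TangentSpace I x) (G : M → ℝ) :
    (ofFrame v₁ v₂).Cost :=
  fun x w => 1 / 2 * G x * (exists_coeff w).choose ^ 2

theorem frameCost_eq (v₁ v₂ : (x : M) → TangentSpace I x) (G : M → ℝ) {x : M} (hx : v₂ x ≠ 0)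
    (w : (ofFrame v₁ v₂).fiber x) (u : ℝ) (hw : (w : TangentSpace I x) = v₁ x + u • v₂ x) :
    frameCost v₁ v₂ G x w = 1 / 2 * G x * u ^ 2 := by
  have h := (exists_coeff w).choose_spec
  have h' : (exists_coeff w).choose • v₂ x = u • v₂ x :=
    add_left_cancel (h.symm.trans hw)
  rw [frameCost, smul_left_injective ℝ hx h']

section Smooth

variable [IsManifold I ∞ M]

/-- The vector field `X` is smooth on the set `U`. -/
def SmoothFieldOn (U : Set M)
    (X : (x : M) → TangentSpace I x) : Prop :=
  ContMDiffOn I I.tangent ∞ (fun x => (⟨x, X x⟩ : TangentBundle I M)) U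

/-- `v` is a smooth nowhere vanishing field on the open set `U` such that
`F_x = drift x + span (v x)` for all `x ∈ U`. -/
def IsLocalFrame (F : PointAffineDistribution I M) (U : Set M)
    (v : (x : M) → TangentSpace I x) : Prop :=
  IsOpen U ∧ SmoothFieldOn U v ∧
    ∀ x ∈ U, v x ≠ 0 ∧ F.fiber x = AffineSubspace.mk' (F.drift x) (Submodule.span ℝ {v x})

/-- `F` is a smooth point-affine distribution of rank 1: the drift is a smooth vector field, and
near every point `F = drift + span v` for a smooth nowhere vanishing vector field `v`. -/
def IsRankOne (F : PointAffineDistribution I M) : Prop :=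
  SmoothFieldOn univ F.drift ∧ ∀ p : M, ∃ U v, p ∈ U ∧ F.IsLocalFrame U v

/-- `F` is strictly affine: no `F_x` is a linear subspace of the tangent space. -/
def IsStrictlyAffine (F : PointAffineDistribution I M) : Prop :=
  ∀ x : M, (0 : TangentSpace I x) ∉ F.fiber x

/-- `X` is a smooth section of `F` over the open set `U`. -/
def IsLocalSection (F : PointAffineDistribution I M) (U : Set M)
    (X : (x : M) → TangentSpace I x) : Prop :=
  IsOpen U ∧ SmoothFieldOn U X ∧ ∀ x ∈ U, X x ∈ F.fiber x

/-- The direction at `x` of the first derived affine distribution `F + [F, F]`: the direction of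
`F_x` together with the values at `x` of all brackets of local sections of `F`. -/
noncomputable def derivedDirection (F : PointAffineDistribution I M) (x : M) :
    Submodule ℝ (TangentSpace I x) :=
  (F.fiber x).direction ⊔ Submodule.span ℝ
    {b | ∃ U X Y, x ∈ U ∧ F.IsLocalSection U X ∧ F.IsLocalSection U Y ∧
      b = VectorField.mlieBracket I X Y x}

/-- Constant type for a rank 1 strictly affine `F` on a surface: the rank of `F + [F, F]` is
constant. With a local frame `(drift, v)` this says that the torsion, the `drift` component of
`[drift, v]`, which is only defined up to nonzero factors, either vanishes identically or vanishes
nowhere. On a surface this determines the growth of the whole flag generated by `F`. -/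
def IsConstantType (F : PointAffineDistribution I M) : Prop :=
  ∀ x y : M, Module.finrank ℝ (F.derivedDirection x) = Module.finrank ℝ (F.derivedDirection y)

/-- `Q` is a smooth positive definite quadratic cost functional on a rank 1 distribution: near
every point, `Q (drift + u v) = g u ^ 2` for a local frame `v` and a smooth function `g > 0`. -/
def IsPosDefQuadratic (F : PointAffineDistribution I M) (Q : F.Cost) : Prop :=
  ∀ p : M, ∃ (U : Set M) (v : (x : M) → TangentSpace I x) (g : M → ℝ),
    p ∈ U ∧ F.IsLocalFrame U v ∧ ContMDiffOn I 𝓘(ℝ, ℝ) ∞ g U ∧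
    ∀ x ∈ U, 0 < g x ∧
      ∀ (w : F.fiber x) (u : ℝ), (w : TangentSpace I x) = F.drift x + u • v x →
        Q x w = g x * u ^ 2

/-- The partial diffeomorphism `φ` is a local point-affine isometry from `(F, Q)` to `(F', Q')`:
its derivative maps drift to drift and affine fibre onto affine fibre, and it preserves the cost. -/
def IsLocalIsometry (F : PointAffineDistribution I M) (Q : F.Cost)
    (F' : PointAffineDistribution I' M') (Q' : F'.Cost)
    (φ : PartialDiffeomorph I I' M M' ∞) : Prop :=
  ∀ x ∈ φ.source,
    mfderiv I I' φ x (F.drift x) = F'.drift (φ x) ∧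
    mfderiv I I' φ x '' (F.fiber x : Set (TangentSpace I x)) =
      (F'.fiber (φ x) : Set (TangentSpace I' (φ x))) ∧
    ∀ (w : F.fiber x) (w' : F'.fiber (φ x)),
      mfderiv I I' φ x (w : TangentSpace I x) = (w' : TangentSpace I' (φ x)) →
        Q' (φ x) w' = Q x w

/-- `(F, Q)` is homogeneous: its local point-affine isometries act transitively on `M`. -/
def IsHomogeneous (F : PointAffineDistribution I M) (Q : F.Cost) : Prop :=
  ∀ p q : M, ∃ φ : PartialDiffeomorph I I M M ∞,
    p ∈ φ.source ∧ φ p = q ∧ F.IsLocalIsometry Q F Q φ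

/-- `(F, Q)` is locally equivalent to the restriction of `(F', Q')` to the open set `U'`: every
point of `M` has a neighbourhood that a local point-affine isometry takes onto an open subset
of `U'`. -/
def IsLocallyEquivalent (F : PointAffineDistribution I M) (Q : F.Cost)
    (F' : PointAffineDistribution I' M') (Q' : F'.Cost) (U' : Set M') : Prop :=
  ∀ p : M, ∃ φ : PartialDiffeomorph I I' M M' ∞,
    p ∈ φ.source ∧ φ.target ⊆ U' ∧ F.IsLocalIsometry Q F' Q' φ

end Smooth

end PointAffineDistribution

/-- The constant coordinate vector field `∂/∂x¹` on the plane. -/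
noncomputable def coordField₁ (x : EuclideanSpace ℝ (Fin 2)) : TangentSpace (𝓡 2) x :=
  (!₂[1, 0] : EuclideanSpace ℝ (Fin 2))

/-- The constant coordinate vector field `∂/∂x²` on the plane. -/
noncomputable def coordField₂ (x : EuclideanSpace ℝ (Fin 2)) : TangentSpace (𝓡 2) x :=
  (!₂[0, 1] : EuclideanSpace ℝ (Fin 2))

/-! ### Brackets under smooth maps, closed one-forms and the inverse function theorem -/

section PlaneFrames

variable {E : Type*} [NormedAddCommGroup E] [NormedSpace ℝ E]
  {E' : Type*} [NormedAddCommGroup E'] [NormedSpace ℝ E']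

/-! The cost rigidifies the structure. If `Q (V + u v) = g u²`, then `W = v / √(2g)` gives `Q (V + u
W) = u² / 2`, and this `W` is unique up to sign; strictness makes `V, W` a frame. Writing `[V, W] =
a V + b W`, a local isometry fixes `V` and sends `W` to `±W`, so it preserves `b` and sends `a` to
`±a` (`IsLocalIsometry.exists_lieBracket_eq`). Homogeneity therefore makes `b` and `a²` constant,
and by continuity the sign of `a` is locally constant (`exists_chart_lieBracket_eq`).

It remains to integrate a frame with constant structure functions. The dual coframe satisfies `dθ₁ =
-a θ₁ ∧ θ₂` and `dθ₂ = -b θ₁ ∧ θ₂`. For `a = 0` the forms `θ₁ = dx₁` and `exp (b x₁) θ₂ = dx₂` are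
closed, which leads to (1.1). For `a ≠ 0` the form `b θ₁ - a θ₂ = df` is closed, and so is `exp f θ₁
= dx₁`; with `x₂ = exp f` this leads to (1.2). The Poincaré lemma supplies the primitives. -/

/-- Fields related by a map of class `C²` have related Lie brackets. -/
theorem fderiv_lieBracket_of_related {f : E → E'} {V W : E → E} {V' W' : E' → E'} {x : E}
    (hf : ContDiffAt ℝ 2 f x) (hV : DifferentiableAt ℝ V x) (hW : DifferentiableAt ℝ W x)
    (hV' : DifferentiableAt ℝ V' (f x)) (hW' : DifferentiableAt ℝ W' (f x))
    (hVV : ∀ᶠ y in 𝓝 x, fderiv ℝ f y (V y) = V' (f y))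
    (hWW : ∀ᶠ y in 𝓝 x, fderiv ℝ f y (W y) = W' (f y)) :
    fderiv ℝ f x (VectorField.lieBracket ℝ V W x) = VectorField.lieBracket ℝ V' W' (f x) := by
  have hf1 : DifferentiableAt ℝ f x := hf.differentiableAt (by norm_num)
  have hdf : DifferentiableAt ℝ (fderiv ℝ f) x :=
    (hf.fderiv_right (m := 1) (by norm_num)).differentiableAt (by norm_num)
  have key : ∀ {X : E → E} {X' : E' → E'}, DifferentiableAt ℝ X x → DifferentiableAt ℝ X' (f x) →
      (∀ᶠ y in 𝓝 x, fderiv ℝ f y (X y) = X' (f y)) → ∀ u,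
      fderiv ℝ (fderiv ℝ f) x u (X x) + fderiv ℝ f x (fderiv ℝ X x u) =
        fderiv ℝ X' (f x) (fderiv ℝ f x u) := by
    intro X X' hX hX' h u
    have h1 : HasFDerivAt (fun y => fderiv ℝ f y (X y)) _ x :=
      hdf.hasFDerivAt.clm_apply hX.hasFDerivAt
    have h2 : HasFDerivAt (fun y => X' (f y)) _ x := hX'.hasFDerivAt.comp x hf1.hasFDerivAt
    have h3 := (h1.congr_of_eventuallyEq (h.mono fun y hy => hy.symm)).unique h2
    have h4 := congrArg (fun T => T u) h3
    simp only [add_apply, ContinuousLinearMap.comp_apply,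
      ContinuousLinearMap.flip_apply] at h4
    rw [← h4, add_comm]
  have hsymm : fderiv ℝ (fderiv ℝ f) x (V x) (W x) = fderiv ℝ (fderiv ℝ f) x (W x) (V x) :=
    (hf.isSymmSndFDerivAt (by simp)).eq _ _
  have e1 := key hW hW' hWW (V x)
  have e2 := key hV hV' hVV (W x)
  rw [hVV.self_of_nhds] at e1
  rw [hWW.self_of_nhds] at e2
  rw [VectorField.lieBracket, VectorField.lieBracket, map_sub, ← e1, ← e2, hsymm]
  abel

/-- The formula `dθ(V, W) = V (θ W) - W (θ V) - θ [V, W]` for the exterior derivative of a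
one-form. -/
theorem fderiv_oneForm_sub {θ : E → E →L[ℝ] ℝ} {V W : E → E} {x : E}
    (hθ : DifferentiableAt ℝ θ x) (hV : DifferentiableAt ℝ V x) (hW : DifferentiableAt ℝ W x) :
    fderiv ℝ θ x (V x) (W x) - fderiv ℝ θ x (W x) (V x) =
      fderiv ℝ (fun y => θ y (W y)) x (V x) - fderiv ℝ (fun y => θ y (V y)) x (W x) -
        θ x (VectorField.lieBracket ℝ V W x) := by
  rw [(hθ.hasFDerivAt.clm_apply hW.hasFDerivAt).fderiv,
    (hθ.hasFDerivAt.clm_apply hV.hasFDerivAt).fderiv, VectorField.lieBracket]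
  simp only [add_apply, ContinuousLinearMap.comp_apply,
      ContinuousLinearMap.flip_apply, map_sub]
  ring

/-- A one-form `θ` is closed if `θ [V, W] = V (θ W) - W (θ V)` for a spanning pair of fields. -/
theorem fderiv_oneForm_comm {θ : E → E →L[ℝ] ℝ} {V W : E → E} {x : E} {f g : E → ℝ}
    {f' g' : E →L[ℝ] ℝ} (hθ : DifferentiableAt ℝ θ x) (hV : DifferentiableAt ℝ V x)
    (hW : DifferentiableAt ℝ W x) (hf : HasFDerivAt f f' x) (hg : HasFDerivAt g g' x)
    (hθV : ∀ᶠ y in 𝓝 x, θ y (V y) = f y) (hθW : ∀ᶠ y in 𝓝 x, θ y (W y) = g y)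
    (h : θ x (VectorField.lieBracket ℝ V W x) = g' (V x) - f' (W x)) :
    fderiv ℝ θ x (V x) (W x) = fderiv ℝ θ x (W x) (V x) := by
  rw [← sub_eq_zero, fderiv_oneForm_sub hθ hV hW, (hg.congr_of_eventuallyEq hθW).fderiv,
    (hf.congr_of_eventuallyEq hθV).fderiv, h, sub_self]

/-- A smooth one-form on an open convex set whose exterior derivative vanishes on a spanning pair
of fields has a smooth primitive. -/
theorem exists_primitive_of_closed_on_frame [CompleteSpace E] {θ : E → E →L[ℝ] ℝ} {V W : E → E}
    {s : Set E} (hs : Convex ℝ s) (hso : IsOpen s) (hθ : ContDiffOn ℝ ∞ θ s)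
    (hspan : ∀ x ∈ s, ∀ u : E, ∃ a b : ℝ, u = a • V x + b • W x)
    (hclosed : ∀ x ∈ s, fderiv ℝ θ x (V x) (W x) = fderiv ℝ θ x (W x) (V x)) :
    ∃ f : E → ℝ, ContDiffOn ℝ ∞ f s ∧ ∀ x ∈ s, HasFDerivAt f (θ x) x := by
  -- The antisymmetrized derivative of `θ` is an alternating form on the span of `V x` and `W x`, so
  -- its value on that pair decides whether it vanishes.
  obtain ⟨f, hf⟩ := hs.exists_forall_hasFDerivAt_of_fderiv_symmetric hso
    (hθ.differentiableOn (by simp)) (fun x hx u v => by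
      obtain ⟨a, b, rfl⟩ := hspan x hx u
      obtain ⟨c, d, rfl⟩ := hspan x hx v
      simp only [map_add, map_smul, add_apply, smul_apply,
        hclosed x hx, smul_eq_mul]
      ring)
  refine ⟨f, ?_, hf⟩
  rw [contDiffOn_infty_iff_fderiv_of_isOpen hso]
  exact ⟨fun x hx => (hf x hx).differentiableAt.differentiableWithinAt,
    hθ.congr fun x hx => (hf x hx).fderiv⟩

/-- The inverse function theorem, as a smooth partial diffeomorphism. -/
theorem exists_partialDiffeomorph_of_injective_fderiv [FiniteDimensional ℝ E] {f : E → E}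
    {s : Set E} (hs : IsOpen s) (hf : ContDiffOn ℝ ∞ f s)
    (hinj : ∀ x ∈ s, Function.Injective (fderiv ℝ f x)) {x : E} (hx : x ∈ s) :
    ∃ Φ : PartialDiffeomorph 𝓘(ℝ, E) 𝓘(ℝ, E) E E ∞,
      x ∈ Φ.source ∧ Φ.source ⊆ s ∧ ∀ y, Φ y = f y := by
  have := FiniteDimensional.complete ℝ E
  -- The equivalence is needed at every point of `s`, since the inverse must be smooth on the whole
  -- target.
  let e : ∀ y ∈ s, E ≃L[ℝ] E := fun y hy =>
    (LinearEquiv.ofInjectiveEndo (fderiv ℝ f y : E →ₗ[ℝ] E) (hinj y hy)).toContinuousLinearEquiv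
  have he : ∀ y (hy : y ∈ s), HasFDerivAt f (e y hy : E →L[ℝ] E) y := fun y hy => by
    have h := ((hf.contDiffAt (hs.mem_nhds hy)).differentiableAt (by simp)).hasFDerivAt
    exact h
  have hc := hf.contDiffAt (hs.mem_nhds hx)
  let φ := (hc.toOpenPartialHomeomorph f (he x hx) (by simp)).restrOpen s hs
  have hsrc : φ.source ⊆ s := fun y hy => hy.2
  refine ⟨⟨φ.toPartialEquiv, φ.open_source, φ.open_target, ?_, ?_⟩, ⟨?_, hx⟩, hsrc, fun y => rfl⟩
  · exact (hf.mono hsrc).contMDiffOn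
  · refine ContDiffOn.contMDiffOn fun y hy => ?_
    have hy' := φ.map_target hy
    exact (φ.contDiffAt_symm hy (he _ (hsrc hy'))
      (hf.contDiffAt (hs.mem_nhds (hsrc hy')))).contDiffWithinAt
  · exact hc.mem_toOpenPartialHomeomorph_source (he x hx) (by simp)

end PlaneFrames

/-! ### Coordinates for frames with constant structure functions -/

section PlaneNormalForm

local notation "ℝ²" => EuclideanSpace ℝ (Fin 2)

theorem exists_smul_add_smul_eq {v w : ℝ²} (h : LinearIndependent ℝ ![v, w]) (u : ℝ²) :
    ∃ a b : ℝ, u = a • v + b • w := by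
  have hs := h.span_eq_top_of_card_eq_finrank' (by simp)
  have hu : u ∈ Submodule.span ℝ (range ![v, w]) := hs ▸ Submodule.mem_top
  rw [Matrix.range_cons, Matrix.range_cons, Matrix.range_empty, union_empty, singleton_union,
    Submodule.mem_span_pair] at hu
  obtain ⟨a, b, rfl⟩ := hu
  exact ⟨a, b, rfl⟩

/-- The smooth coframe dual to a smooth frame of the plane. -/
theorem exists_dual_coframe {V W : ℝ² → ℝ²} {s : Set ℝ²}
    (hV : ContDiffOn ℝ ∞ V s) (hW : ContDiffOn ℝ ∞ W s)
    (hVW : ∀ x ∈ s, LinearIndependent ℝ ![V x, W x]) :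
    ∃ θ₁ θ₂ : ℝ² → ℝ² →L[ℝ] ℝ, ContDiffOn ℝ ∞ θ₁ s ∧ ContDiffOn ℝ ∞ θ₂ s ∧
      ∀ x ∈ s, θ₁ x (V x) = 1 ∧ θ₁ x (W x) = 0 ∧ θ₂ x (V x) = 0 ∧ θ₂ x (W x) = 1 := by
  let pr : Fin 2 → ℝ² →L[ℝ] ℝ := EuclideanSpace.proj
  -- `A x` carries the standard basis to the frame, so the rows of its inverse form the dual
  -- coframe; smoothness comes from that of operator inversion.
  let A : ℝ² → ℝ² →L[ℝ] ℝ² := fun x => (pr 0).smulRight (V x) + (pr 1).smulRight (W x)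
  have hA : ContDiffOn ℝ ∞ A s :=
    (contDiffOn_const.smulRight hV).add (contDiffOn_const.smulRight hW)
  have hAapp : ∀ x u, A x u = u 0 • V x + u 1 • W x := fun x u => rfl
  have hequiv : ∀ x ∈ s, ∃ e : ℝ² ≃L[ℝ] ℝ², (e : ℝ² →L[ℝ] ℝ²) = A x := fun x hx => by
    have hinj : Function.Injective (A x : ℝ² →ₗ[ℝ] ℝ²) := by
      rw [← LinearMap.ker_eq_bot, LinearMap.ker_eq_bot']
      intro u hu
      have hu' : u 0 • V x + u 1 • W x = 0 := hu
      obtain ⟨h0, h1⟩ := LinearIndependent.pair_iff.1 (hVW x hx) _ _ hu'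
      ext i
      fin_cases i
      · exact h0
      · exact h1
    exact ⟨(LinearEquiv.ofInjectiveEndo _ hinj).toContinuousLinearEquiv, rfl⟩
  have hinv : ContDiffOn ℝ ∞ (fun x => (A x).inverse) s := fun x hx => by
    obtain ⟨e, he⟩ := hequiv x hx
    have h : ContDiffAt ℝ ∞ ContinuousLinearMap.inverse (A x) := he ▸ contDiffAt_map_inverse e
    exact h.comp_contDiffWithinAt x (hA x hx)
  have hinvA : ∀ x ∈ s, ∀ u, (A x).inverse (A x u) = u := fun x hx u => by
    obtain ⟨e, he⟩ := hequiv x hx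
    rw [← he, ContinuousLinearMap.inverse_equiv]
    simp
  refine ⟨fun x => (pr 0).comp (A x).inverse, fun x => (pr 1).comp (A x).inverse,
    contDiffOn_const.clm_comp hinv, contDiffOn_const.clm_comp hinv, fun x hx => ?_⟩
  have e1 : A x !₂[1, 0] = V x := by simp [hAapp]
  have e2 : A x !₂[0, 1] = W x := by simp [hAapp]
  have i1 := hinvA x hx !₂[1, 0]
  have i2 := hinvA x hx !₂[0, 1]
  rw [e1] at i1
  rw [e2] at i2
  simp only [ContinuousLinearMap.comp_apply, i1, i2]
  simp [pr]

/-- Two functions with independent differentials are local coordinates. -/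
theorem exists_coordinates {f₁ f₂ : ℝ² → ℝ} {ω₁ ω₂ : ℝ² → ℝ² →L[ℝ] ℝ} {s : Set ℝ²}
    (hs : IsOpen s) (h₁ : ContDiffOn ℝ ∞ f₁ s) (h₂ : ContDiffOn ℝ ∞ f₂ s)
    (hd₁ : ∀ x ∈ s, HasFDerivAt f₁ (ω₁ x) x) (hd₂ : ∀ x ∈ s, HasFDerivAt f₂ (ω₂ x) x)
    (hker : ∀ x ∈ s, ∀ u, ω₁ x u = 0 → ω₂ x u = 0 → u = 0) {x : ℝ²} (hx : x ∈ s) :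
    ∃ Φ : PartialDiffeomorph (𝓡 2) (𝓡 2) ℝ² ℝ² ∞, x ∈ Φ.source ∧ Φ.source ⊆ s ∧
      (∀ y, Φ y = !₂[f₁ y, f₂ y]) ∧
      ∀ y ∈ s, ∀ u, fderiv ℝ Φ y u = !₂[ω₁ y u, ω₂ y u] := by
  let f : ℝ² → ℝ² := fun y => !₂[f₁ y, f₂ y]
  have hf : ContDiffOn ℝ ∞ f s := by
    rw [contDiffOn_piLp]
    intro i
    fin_cases i
    · exact h₁
    · exact h₂
  have hd : ∀ y ∈ s, ∀ u, fderiv ℝ f y u = !₂[ω₁ y u, ω₂ y u] := fun y hy u => by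
    have hfd : HasFDerivAt f (fderiv ℝ f y) y :=
      ((hf.contDiffAt (hs.mem_nhds hy)).differentiableAt (by simp)).hasFDerivAt
    have hc : ∀ i : Fin 2, HasFDerivAt (fun z => f z i) _ y := fun i =>
      (EuclideanSpace.proj i : ℝ² →L[ℝ] ℝ).hasFDerivAt.comp y hfd
    ext i
    fin_cases i
    · exact congrArg (fun T => T u) ((hc 0).unique (hd₁ y hy))
    · exact congrArg (fun T => T u) ((hc 1).unique (hd₂ y hy))
  obtain ⟨Φ, hxΦ, hΦs, hΦ⟩ := exists_partialDiffeomorph_of_injective_fderiv hs hf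
    (fun y hy => (injective_iff_map_eq_zero _).2 fun u hu => by
      rw [hd y hy u] at hu
      exact hker y hy u (congrArg (fun z : ℝ² => z 0) hu) (congrArg (fun z : ℝ² => z 1) hu)) hx
  have hΦf : Φ.toFun = f := funext hΦ
  exact ⟨Φ, hxΦ, hΦs, hΦ, fun y hy u => by rw [hΦf, hd y hy u]⟩

variable {V W : ℝ² → ℝ²} {s : Set ℝ²} {a b : ℝ}

/-- A frame of the plane with `[V, W] = b W` is, in suitable coordinates, `∂₁, exp (b x₁) ∂₂`. -/
theorem exists_coordinates_of_lieBracket_eq_smul (hs : IsOpen s)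
    (hV : ContDiffOn ℝ ∞ V s) (hW : ContDiffOn ℝ ∞ W s)
    (hVW : ∀ x ∈ s, LinearIndependent ℝ ![V x, W x])
    (hbr : ∀ x ∈ s, VectorField.lieBracket ℝ V W x = b • W x) {x : ℝ²} (hx : x ∈ s) :
    ∃ Φ : PartialDiffeomorph (𝓡 2) (𝓡 2) ℝ² ℝ² ∞, x ∈ Φ.source ∧
      ∀ y ∈ Φ.source, y ∈ s ∧ fderiv ℝ Φ y (V y) = !₂[1, 0] ∧
        fderiv ℝ Φ y (W y) = !₂[0, Real.exp (b * Φ y 0)] := by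
  -- A ball is convex, as the Poincaré lemma requires.
  obtain ⟨r, hr, hrs⟩ := Metric.isOpen_iff.1 hs x hx
  set t := Metric.ball x r
  have ht : IsOpen t := Metric.isOpen_ball
  have htc : Convex ℝ t := convex_ball x r
  obtain ⟨θ₁, θ₂, hθ₁, hθ₂, hθ⟩ := exists_dual_coframe (hV.mono hrs) (hW.mono hrs)
    fun y hy => hVW y (hrs hy)
  have hspan : ∀ y ∈ t, ∀ u : ℝ², ∃ a b : ℝ, u = a • V y + b • W y :=
    fun y hy => exists_smul_add_smul_eq (hVW y (hrs hy))
  have hdV : ∀ y ∈ t, DifferentiableAt ℝ V y := fun y hy =>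
    (hV.contDiffAt (hs.mem_nhds (hrs hy))).differentiableAt (by simp)
  have hdW : ∀ y ∈ t, DifferentiableAt ℝ W y := fun y hy =>
    (hW.contDiffAt (hs.mem_nhds (hrs hy))).differentiableAt (by simp)
  -- `θ₁` is closed because `[V, W]` has no `V` component.
  obtain ⟨f₁, hf₁, hdf₁⟩ := exists_primitive_of_closed_on_frame htc ht hθ₁ hspan fun y hy => fderiv_oneForm_comm
    ((hθ₁.contDiffAt (ht.mem_nhds hy)).differentiableAt (by simp)) (hdV y hy) (hdW y hy)
    (hasFDerivAt_const 1 y) (hasFDerivAt_const 0 y)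
    (Filter.eventually_of_mem (ht.mem_nhds hy) fun z hz => by simp [hθ z hz])
    (Filter.eventually_of_mem (ht.mem_nhds hy) fun z hz => by simp [hθ z hz])
    (by simp [hbr y (hrs hy), hθ y hy])
  -- Integrating factor for `θ₂`: `d(exp (b f₁)) = b exp (b f₁) θ₁` cancels `dθ₂ = -b θ₁ ∧ θ₂`.
  have hexp : ContDiffOn ℝ ∞ (fun y => Real.exp (b * f₁ y)) t := (contDiffOn_const.mul hf₁).exp
  have hω : ContDiffOn ℝ ∞ (fun y => Real.exp (b * f₁ y) • θ₂ y) t := hexp.smul hθ₂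
  obtain ⟨f₂, hf₂, hdf₂⟩ := exists_primitive_of_closed_on_frame htc ht hω hspan fun y hy => fderiv_oneForm_comm
    ((hω.contDiffAt (ht.mem_nhds hy)).differentiableAt (by simp)) (hdV y hy) (hdW y hy)
    (hasFDerivAt_const 0 y) ((hdf₁ y hy).const_mul b).exp
    (Filter.eventually_of_mem (ht.mem_nhds hy) fun z hz => by simp [hθ z hz])
    (Filter.eventually_of_mem (ht.mem_nhds hy) fun z hz => by simp [hθ z hz])
    (by simp [hbr y (hrs hy), hθ y hy]; ring)
  obtain ⟨Φ, hxΦ, hΦt, hΦ, hΦd⟩ := exists_coordinates ht hf₁ hf₂ hdf₁ hdf₂ (fun y hy u h1 h2 => by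
    obtain ⟨c, d, rfl⟩ := hspan y hy u
    simp only [map_add, map_smul, hθ y hy, smul_apply, smul_eq_mul] at h1 h2
    have hc : c = 0 := by simpa using h1
    have hd : d = 0 := by simpa using h2
    simp [hc, hd]) (Metric.mem_ball_self hr)
  refine ⟨Φ, hxΦ, fun y hy => ⟨hrs (hΦt hy), ?_, ?_⟩⟩
  · rw [hΦd y (hΦt hy)]
    simp [hθ y (hΦt hy)]
  · rw [hΦd y (hΦt hy), hΦ y]
    simp [hθ y (hΦt hy)]

/-- A frame of the plane with `[V, W] = a V + b W` is, in suitable coordinates,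
`x₂ (∂₁ + b ∂₂), -a x₂ ∂₂`, provided that `a ≠ 0`. -/
theorem exists_coordinates_of_lieBracket_eq_add (ha : a ≠ 0) (hs : IsOpen s)
    (hV : ContDiffOn ℝ ∞ V s) (hW : ContDiffOn ℝ ∞ W s)
    (hVW : ∀ x ∈ s, LinearIndependent ℝ ![V x, W x])
    (hbr : ∀ x ∈ s, VectorField.lieBracket ℝ V W x = a • V x + b • W x) {x : ℝ²} (hx : x ∈ s) :
    ∃ Φ : PartialDiffeomorph (𝓡 2) (𝓡 2) ℝ² ℝ² ∞, x ∈ Φ.source ∧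
      ∀ y ∈ Φ.source, y ∈ s ∧ Φ y 1 ≠ 0 ∧ fderiv ℝ Φ y (V y) = !₂[Φ y 1, Φ y 1 * b] ∧
        fderiv ℝ Φ y (W y) = !₂[0, -a * Φ y 1] := by
  obtain ⟨r, hr, hrs⟩ := Metric.isOpen_iff.1 hs x hx
  set t := Metric.ball x r
  have ht : IsOpen t := Metric.isOpen_ball
  have htc : Convex ℝ t := convex_ball x r
  obtain ⟨θ₁, θ₂, hθ₁, hθ₂, hθ⟩ := exists_dual_coframe (hV.mono hrs) (hW.mono hrs)
    fun y hy => hVW y (hrs hy)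
  have hspan : ∀ y ∈ t, ∀ u : ℝ², ∃ a b : ℝ, u = a • V y + b • W y :=
    fun y hy => exists_smul_add_smul_eq (hVW y (hrs hy))
  have hdV : ∀ y ∈ t, DifferentiableAt ℝ V y := fun y hy =>
    (hV.contDiffAt (hs.mem_nhds (hrs hy))).differentiableAt (by simp)
  have hdW : ∀ y ∈ t, DifferentiableAt ℝ W y := fun y hy =>
    (hW.contDiffAt (hs.mem_nhds (hrs hy))).differentiableAt (by simp)
  -- The combination of `θ₁` and `θ₂` that annihilates `[V, W] = a V + b W`, hence closed.
  have hη : ContDiffOn ℝ ∞ (fun y => b • θ₁ y - a • θ₂ y) t :=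
    (hθ₁.const_smul b).sub (hθ₂.const_smul a)
  obtain ⟨f, hf, hdf⟩ := exists_primitive_of_closed_on_frame htc ht hη hspan fun y hy => fderiv_oneForm_comm
    ((hη.contDiffAt (ht.mem_nhds hy)).differentiableAt (by simp)) (hdV y hy) (hdW y hy)
    (hasFDerivAt_const b y) (hasFDerivAt_const (-a) y)
    (Filter.eventually_of_mem (ht.mem_nhds hy) fun z hz => by simp [hθ z hz])
    (Filter.eventually_of_mem (ht.mem_nhds hy) fun z hz => by simp [hθ z hz])
    (by simp [hbr y (hrs hy), hθ y hy]; ring)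
  have hexp : ContDiffOn ℝ ∞ (fun y => Real.exp (f y)) t := hf.exp
  -- Closed because `df ∧ θ₁ = a θ₁ ∧ θ₂ = -dθ₁`.
  have hω : ContDiffOn ℝ ∞ (fun y => Real.exp (f y) • θ₁ y) t := hexp.smul hθ₁
  obtain ⟨f₁, hf₁, hdf₁⟩ := exists_primitive_of_closed_on_frame htc ht hω hspan fun y hy => fderiv_oneForm_comm
    ((hω.contDiffAt (ht.mem_nhds hy)).differentiableAt (by simp)) (hdV y hy) (hdW y hy)
    (hdf y hy).exp (hasFDerivAt_const 0 y)
    (Filter.eventually_of_mem (ht.mem_nhds hy) fun z hz => by simp [hθ z hz])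
    (Filter.eventually_of_mem (ht.mem_nhds hy) fun z hz => by simp [hθ z hz])
    (by simp [hbr y (hrs hy), hθ y hy])
  -- The integrating factor itself is the second coordinate, hence nonzero; `a ≠ 0` makes its
  -- differential independent of `θ₁`.
  obtain ⟨Φ, hxΦ, hΦt, hΦ, hΦd⟩ := exists_coordinates ht hf₁ hexp hdf₁ (fun y hy => (hdf y hy).exp)
    (fun y hy u h1 h2 => by
      obtain ⟨c, d, rfl⟩ := hspan y hy u
      have hc : c = 0 := by simpa [hθ y hy] using h1
      have hd : d = 0 := by simpa [hθ y hy, hc, ha] using h2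
      simp [hc, hd]) (Metric.mem_ball_self hr)
  refine ⟨Φ, hxΦ, fun y hy => ⟨hrs (hΦt hy), ?_, ?_, ?_⟩⟩
  · rw [hΦ y]
    exact (Real.exp_pos _).ne'
  · rw [hΦd y (hΦt hy), hΦ y]
    simp [hθ y (hΦt hy)]
  · rw [hΦd y (hΦt hy), hΦ y]
    simp [hθ y (hΦt hy)]
    ring

end PlaneNormalForm

/-! ### Composition of isometries and isometries to framed structures -/

namespace PointAffineDistribution

section Isometries

variable {E : Type*} [NormedAddCommGroup E] [NormedSpace ℝ E]
  {H : Type*} [TopologicalSpace H] {I : ModelWithCorners ℝ E H}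
  {M : Type*} [TopologicalSpace M] [ChartedSpace H M]
  {E' : Type*} [NormedAddCommGroup E'] [NormedSpace ℝ E']
  {H' : Type*} [TopologicalSpace H'] {I' : ModelWithCorners ℝ E' H'}
  {M' : Type*} [TopologicalSpace M'] [ChartedSpace H' M']
  {E'' : Type*} [NormedAddCommGroup E''] [NormedSpace ℝ E'']
  {H'' : Type*} [TopologicalSpace H''] {I'' : ModelWithCorners ℝ E'' H''}
  {M'' : Type*} [TopologicalSpace M''] [ChartedSpace H'' M'']

theorem mem_mk'_span_singleton_iff {v₁ v₂ w : E} :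
    w ∈ AffineSubspace.mk' v₁ (Submodule.span ℝ {v₂}) ↔ ∃ u : ℝ, w = v₁ + u • v₂ := by
  rw [AffineSubspace.mem_mk', vsub_eq_sub, Submodule.mem_span_singleton]
  exact ⟨fun ⟨u, hu⟩ => ⟨u, by rw [hu]; abel⟩, fun ⟨u, hu⟩ => ⟨u, by rw [hu]; abel⟩⟩

/-- Serves to follow a self-isometry by a chart, and a chart by a change of coordinates. -/
theorem IsLocalIsometry.trans
    {F : PointAffineDistribution I M} {Q : F.Cost}
    {F' : PointAffineDistribution I' M'} {Q' : F'.Cost}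
    {F'' : PointAffineDistribution I'' M''} {Q'' : F''.Cost}
    {φ : PartialDiffeomorph I I' M M' ∞} {ψ : PartialDiffeomorph I' I'' M' M'' ∞}
    (hφ : F.IsLocalIsometry Q F' Q' φ) (hψ : F'.IsLocalIsometry Q' F'' Q'' ψ) :
    F.IsLocalIsometry Q F'' Q'' (φ.trans ψ) := by
  intro x hx
  obtain ⟨d₁, i₁, q₁⟩ := hφ x hx.1
  obtain ⟨d₂, i₂, q₂⟩ := hψ (φ x) hx.2
  have hD : mfderiv I I'' (φ.trans ψ) x = (mfderiv I' I'' ψ (φ x)).comp (mfderiv I I' φ x) :=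
    mfderiv_comp x (ψ.mdifferentiableAt (by simp) hx.2) (φ.mdifferentiableAt (by simp) hx.1)
  have hDa : ∀ w, mfderiv I I'' (φ.trans ψ) x w = mfderiv I' I'' ψ (φ x) (mfderiv I I' φ x w) :=
    fun w => congrArg (fun T => T w) hD
  refine ⟨(hDa _).trans ((congrArg _ d₁).trans d₂), ?_, fun w w'' hw => ?_⟩
  · have h : mfderiv I I'' (φ.trans ψ) x '' (F.fiber x : Set (TangentSpace I x)) =
        mfderiv I' I'' ψ (φ x) '' (mfderiv I I' φ x '' (F.fiber x : Set (TangentSpace I x))) := by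
      rw [image_image]
      exact image_congr fun w _ => hDa w
    rw [h, i₁]
    exact i₂
  · have hw' : mfderiv I I' φ x (w : TangentSpace I x) ∈ F'.fiber (φ x) := by
      rw [← SetLike.mem_coe, ← i₁]
      exact mem_image_of_mem _ w.2
    exact (q₂ ⟨_, hw'⟩ w'' ((hDa _).symm.trans hw)).trans (q₁ w ⟨_, hw'⟩ rfl)

/-- A map is an isometry to a framed structure as soon as it is one on frames. -/
theorem isLocalIsometry_ofFrame
    {F : PointAffineDistribution I M} {Q : F.Cost} {v₁ v₂ : (x : M') → TangentSpace I' x}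
    {G : M' → ℝ} {φ : PartialDiffeomorph I I' M M' ∞}
    (h : ∀ x ∈ φ.source, ∃ (w : TangentSpace I x) (c : ℝ), c ≠ 0 ∧ v₂ (φ x) ≠ 0 ∧
      F.fiber x = AffineSubspace.mk' (F.drift x) (Submodule.span ℝ {w}) ∧
      mfderiv I I' φ x (F.drift x) = v₁ (φ x) ∧ mfderiv I I' φ x w = c • v₂ (φ x) ∧
      ∀ (z : F.fiber x) (u : ℝ), (z : TangentSpace I x) = F.drift x + u • w →
        Q x z = 1 / 2 * G (φ x) * (u * c) ^ 2) :
    F.IsLocalIsometry Q (ofFrame v₁ v₂) (frameCost v₁ v₂ G) φ := by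
  intro x hx
  obtain ⟨w, c, hc, hv, hfib, hd, hw, hQ⟩ := h x hx
  have hDa : ∀ u : ℝ, mfderiv I I' φ x (F.drift x + u • w) = v₁ (φ x) + (u * c) • v₂ (φ x) :=
    fun u => by rw [map_add, map_smul, hd, hw, smul_smul]
  have hmem : ∀ z, z ∈ F.fiber x ↔ ∃ u : ℝ, z = F.drift x + u • w := fun z => by
    rw [hfib]
    exact mem_mk'_span_singleton_iff (E := E)
  refine ⟨hd, ?_, fun z z' hz => ?_⟩
  · ext z'
    constructor
    · rintro ⟨z, hz, rfl⟩
      obtain ⟨u, rfl⟩ := (hmem z).1 hz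
      exact (mem_mk'_span_singleton_iff (E := E')).2 ⟨u * c, hDa u⟩
    · intro hz'
      obtain ⟨u, rfl⟩ := (mem_mk'_span_singleton_iff (E := E')).1 hz'
      refine ⟨F.drift x + (u / c) • w, (hmem _).2 ⟨_, rfl⟩, ?_⟩
      rw [hDa, div_mul_cancel₀ _ hc]
      rfl
  · obtain ⟨u, hu⟩ := (hmem z).1 z.2
    rw [hQ z u hu]
    refine frameCost_eq v₁ v₂ G hv z' (u * c) ?_
    rw [← hz, hu, hDa]

end Isometries

/-! ### Normalized charts and their transition maps -/

section Plane

local notation "ℝ²" => EuclideanSpace ℝ (Fin 2)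

variable {M : Type*} [TopologicalSpace M] [ChartedSpace ℝ² M] [IsManifold (𝓡 2) ∞ M]
  {F : PointAffineDistribution (𝓡 2) M} {Q : F.Cost}

omit [IsManifold (𝓡 2) ∞ M] in
/-- Two isometries to normalized frames are related by a map that respects the frames, up to the
sign of the second vector. -/
theorem IsLocalIsometry.fderiv_transition {V W V' W' : ℝ² → ℝ²}
    {κ κ' : PartialDiffeomorph (𝓡 2) (𝓡 2) M ℝ² ∞}
    (hκ : F.IsLocalIsometry Q (ofFrame (I := 𝓡 2) V W) (frameCost (I := 𝓡 2) V W fun _ => 1) κ)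
    (hκ' : F.IsLocalIsometry Q (ofFrame (I := 𝓡 2) V' W')
      (frameCost (I := 𝓡 2) V' W' fun _ => 1) κ')
    {m : M} (hm : m ∈ κ.source) (hm' : m ∈ κ'.source) (hW : W (κ m) ≠ 0) (hW' : W' (κ' m) ≠ 0) :
    fderiv ℝ (κ.symm.trans κ') (κ m) (V (κ m)) = V' (κ' m) ∧
      ∃ c : ℝ, c ^ 2 = 1 ∧ fderiv ℝ (κ.symm.trans κ') (κ m) (W (κ m)) = c • W' (κ' m) := by
  set ψ := κ.symm.trans κ'
  have hinv : κ.symm (κ m) = m := κ.left_inv hm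
  have hmψ : κ m ∈ ψ.source := by
    refine ⟨κ.map_source hm, ?_⟩
    change κ.symm (κ m) ∈ κ'.source
    rwa [hinv]
  obtain ⟨d, i, q⟩ := hκ m hm
  obtain ⟨d', i', q'⟩ := hκ' m hm'
  have hcomp : (ψ.toFun ∘ κ.toFun) =ᶠ[𝓝 m] κ'.toFun :=
    Filter.eventually_of_mem (κ.open_source.mem_nhds hm)
      fun z hz => congrArg κ'.toFun (κ.left_inv hz)
  have hD : ∀ w, fderiv ℝ ψ (κ m) (mfderiv (𝓡 2) (𝓡 2) κ m w) = mfderiv (𝓡 2) (𝓡 2) κ' m w :=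
    fun w => by
      have h := mfderiv_comp m (ψ.mdifferentiableAt (by simp) hmψ)
        (κ.mdifferentiableAt (by simp) hm)
      rw [hcomp.mfderiv_eq, mfderiv_eq_fderiv] at h
      exact (congrArg (fun T => T w) h).symm
  have hV : fderiv ℝ ψ (κ m) (V (κ m)) = V' (κ' m) :=
    (congrArg (fderiv ℝ ψ (κ m)) d.symm).trans ((hD _).trans d')
  refine ⟨hV, ?_⟩
  -- The vector `V + W` has cost `1/2` and its image `V' + c W'` has cost `c² / 2`, so `c² = 1`.
  have hmem : (V (κ m) + (1 : ℝ) • W (κ m) : ℝ²) ∈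
      (ofFrame (I := 𝓡 2) V W).fiber (κ m) := mem_mk'_span_singleton_iff.2 ⟨1, rfl⟩
  obtain ⟨w, hw, hwe⟩ := i.symm.subset hmem
  have hw' := i'.subset (mem_image_of_mem _ hw)
  obtain ⟨c, hc⟩ := (mem_mk'_span_singleton_iff (E := ℝ²)).1 hw'
  have e₁ := q ⟨w, hw⟩ ⟨_, hmem⟩ hwe
  have e₂ := q' ⟨w, hw⟩ ⟨_, hw'⟩ rfl
  rw [frameCost_eq (I := 𝓡 2) V W _ hW _ 1 rfl] at e₁
  rw [frameCost_eq (I := 𝓡 2) V' W' _ hW' _ c hc, ← e₁] at e₂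
  refine ⟨c, by linarith, ?_⟩
  have h := hD w
  rw [hwe, hc] at h
  rw [map_add, hV, one_smul] at h
  exact add_left_cancel h

/-- A rank one strictly affine structure on a surface has, near every point, a chart in which it is
given by a smooth frame with `Q (V + u W) = u ^ 2 / 2`. -/
theorem exists_normalized_chart (hF : F.IsRankOne) (hstrict : F.IsStrictlyAffine)
    (hQ : F.IsPosDefQuadratic Q) (p : M) :
    ∃ (κ : PartialDiffeomorph (𝓡 2) (𝓡 2) M ℝ² ∞) (V W : ℝ² → ℝ²), p ∈ κ.source ∧
      ContDiffOn ℝ ∞ V κ.target ∧ ContDiffOn ℝ ∞ W κ.target ∧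
      (∀ y ∈ κ.target, LinearIndependent ℝ ![V y, W y]) ∧
      F.IsLocalIsometry Q (ofFrame (I := 𝓡 2) V W) (frameCost (I := 𝓡 2) V W fun _ => 1) κ := by
  obtain ⟨U, v, g, hpU, ⟨hU, hv, hfr⟩, hg, hgQ⟩ := hQ p
  let e := (chartAt ℝ² p).restrOpen U hU
  let κ : PartialDiffeomorph (𝓡 2) (𝓡 2) M ℝ² ∞ :=
    { toPartialEquiv := e.toPartialEquiv
      open_source := e.open_source
      open_target := e.open_target
      contMDiffOn_toFun := contMDiffOn_chart.mono fun x hx => hx.1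
      contMDiffOn_invFun := contMDiffOn_chart_symm.mono fun x hx => hx.1 }
  have hκU : κ.source ⊆ U := fun x hx => hx.2
  -- The pushed-forward field is `X` followed by the tangent map, read in the trivial tangent bundle
  -- of the plane.
  have push : ∀ X : (x : M) → TangentSpace (𝓡 2) x, SmoothFieldOn (I := 𝓡 2) κ.source X →
      ContDiffOn ℝ ∞ (fun y => (mfderiv (𝓡 2) (𝓡 2) κ (κ.symm y) (X (κ.symm y)) : ℝ²))
        κ.target := by
    intro X hX
    have h1 := κ.contMDiffOn_toFun.contMDiffOn_tangentMapWithin (m := ∞) (by simp)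
      κ.open_source.uniqueMDiffOn
    have h2 := h1.comp hX fun x hx => hx
    have h3 := h2.comp κ.contMDiffOn_invFun fun y hy => κ.map_target hy
    have h4 := (contMDiff_snd_tangentBundle_modelSpace ℝ² (𝓡 2) (n := ∞)).comp_contMDiffOn h3
    refine (contMDiffOn_iff_contDiffOn.1 h4).congr fun y hy => ?_
    have h5 := mfderivWithin_of_isOpen (I := 𝓡 2) (I' := 𝓡 2) (f := κ.toFun) κ.open_source
      (κ.map_target hy)
    exact congrArg (fun T => T (X (κ.symm y))) h5.symm
  have hv' : SmoothFieldOn (I := 𝓡 2) κ.source v := hv.mono hκU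
  have hd' : SmoothFieldOn (I := 𝓡 2) κ.source F.drift := hF.1.mono (subset_univ _)
  have hgκ : ContDiffOn ℝ ∞ (fun y => g (κ.symm y)) κ.target :=
    contMDiffOn_iff_contDiffOn.1
      ((hg.mono hκU).comp κ.contMDiffOn_invFun fun y hy => κ.map_target hy)
  have hgpos : ∀ x ∈ κ.source, 0 < Real.sqrt (2 * g x) := fun x hx =>
    Real.sqrt_pos.2 (mul_pos two_pos (hgQ x (hκU hx)).1)
  have hc : ContDiffOn ℝ ∞ (fun y => (Real.sqrt (2 * g (κ.symm y)))⁻¹) κ.target :=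
    ((contDiffOn_const.mul hgκ).sqrt fun y hy =>
      (mul_pos two_pos (hgQ _ (hκU (κ.map_target hy))).1).ne').inv
      fun y hy => (hgpos _ (κ.map_target hy)).ne'
  let V : ℝ² → ℝ² := fun y => mfderiv (𝓡 2) (𝓡 2) κ (κ.symm y) (F.drift (κ.symm y))
  let W : ℝ² → ℝ² := fun y => (Real.sqrt (2 * g (κ.symm y)))⁻¹ •
    (mfderiv (𝓡 2) (𝓡 2) κ (κ.symm y) (v (κ.symm y)) : ℝ²)
  have hVx : ∀ x ∈ κ.source, V (κ x) = mfderiv (𝓡 2) (𝓡 2) κ x (F.drift x) := fun x hx =>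
    congrArg (fun z => (mfderiv (𝓡 2) (𝓡 2) κ z (F.drift z) : ℝ²)) (κ.left_inv hx)
  have hWx : ∀ x ∈ κ.source, W (κ x) =
      (Real.sqrt (2 * g x))⁻¹ • (mfderiv (𝓡 2) (𝓡 2) κ x (v x) : ℝ²) := fun x hx =>
    congrArg (fun z => (Real.sqrt (2 * g z))⁻¹ • (mfderiv (𝓡 2) (𝓡 2) κ z (v z) : ℝ²))
      (κ.left_inv hx)
  have hli : ∀ y ∈ κ.target, LinearIndependent ℝ ![V y, W y] := by
    intro y hy
    obtain ⟨x, hx, rfl⟩ : ∃ x ∈ κ.source, κ x = y := ⟨_, κ.map_target hy, κ.right_inv hy⟩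
    have hinj : Function.Injective (mfderiv (𝓡 2) (𝓡 2) κ x) := by
      have h := (κ.isLocalDiffeomorphAt (𝓡 2) (𝓡 2) ∞ hx)
      exact (h.mfderivToContinuousLinearEquiv (by simp)).injective
    rw [LinearIndependent.pair_iff]
    intro a b hab
    rw [hVx x hx, hWx x hx] at hab
    have hzero : a • F.drift x + (b * (Real.sqrt (2 * g x))⁻¹) • v x = 0 := by
      apply hinj
      rw [map_add, map_smul, map_smul, map_zero, mul_smul]
      exact hab
    have ha : a = 0 := by
      by_contra ha
      -- A nonzero `a` would make the drift a multiple of `v`, placing `0` in the affine line.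
      refine hstrict x ?_
      rw [(hfr x (hκU hx)).2]
      refine (mem_mk'_span_singleton_iff (E := ℝ²)).2 ⟨b * (Real.sqrt (2 * g x))⁻¹ / a, ?_⟩
      have h := congrArg (fun z => a⁻¹ • z) hzero
      simp only [smul_add, smul_smul, inv_mul_cancel₀ ha, one_smul, smul_zero] at h
      rw [div_eq_inv_mul]
      exact h.symm
    refine ⟨ha, ?_⟩
    rw [ha, zero_smul, zero_add, smul_eq_zero, mul_eq_zero] at hzero
    exact (hzero.resolve_right (hfr x (hκU hx)).1).resolve_right (inv_ne_zero (hgpos x hx).ne')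
  refine ⟨κ, V, W, ⟨mem_chart_source ℝ² p, hpU⟩, push _ hd', hc.smul (push _ hv'), hli,
    isLocalIsometry_ofFrame fun x hx => ⟨v x, Real.sqrt (2 * g x), (hgpos x hx).ne', ?_,
      (hfr x (hκU hx)).2, (hVx x hx).symm, ?_, fun z u hz => ?_⟩⟩
  · exact (hli _ (κ.map_source hx)).ne_zero 1
  · rw [hWx x hx, smul_smul, mul_inv_cancel₀ (hgpos x hx).ne', one_smul]
  · rw [(hgQ x (hκU hx)).2 z u hz, mul_pow,
      Real.sq_sqrt (mul_pos two_pos (hgQ x (hκU hx)).1).le]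
    ring

end Plane

end PointAffineDistribution

/-! ### Constancy of the structure functions under homogeneity -/

namespace PointAffineDistribution

section Homogeneous

local notation "ℝ²" => EuclideanSpace ℝ (Fin 2)

/-- Two continuous nonvanishing fields that agree up to a sign at each point agree up to a
constant sign near each point. -/
theorem exists_eventually_eq_smul_of_sq_eq_one {X E : Type*} [TopologicalSpace X]
    [NormedAddCommGroup E] [InnerProductSpace ℝ E] {f g : X → E} {x : X}
    (hf : ContinuousAt f x) (hg : ContinuousAt g x) (hgx : g x ≠ 0)
    (h : ∀ᶠ y in 𝓝 x, ∃ c : ℝ, c ^ 2 = 1 ∧ f y = c • g y) :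
    ∃ c : ℝ, c ^ 2 = 1 ∧ ∀ᶠ y in 𝓝 x, f y = c • g y := by
  obtain ⟨c, hc, hfx⟩ := h.self_of_nhds
  refine ⟨c, hc, ?_⟩
  -- This inner product is positive at `x`, hence nearby; where `f y = d • g y`, this forces `d c >
  -- 0`, so the signs `d` and `c` agree.
  have hcont : ContinuousAt (fun y => inner ℝ (f y) (c • g y)) x := hf.inner (hg.const_smul c)
  have hc0 : c ≠ 0 := by rintro rfl; norm_num at hc
  have hpos : 0 < inner ℝ (f x) (c • g x) := by
    rw [hfx]
    exact real_inner_self_pos.2 (smul_ne_zero hc0 hgx)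
  filter_upwards [h, hcont.eventually (lt_mem_nhds hpos)] with y ⟨d, hd, hy⟩ hpos'
  rw [hy, inner_smul_left, inner_smul_right, ← mul_assoc] at hpos'
  have hdc : 0 < d * c := pos_of_mul_pos_left hpos' real_inner_self_nonneg
  rw [hy, show d = c by nlinarith [sq_nonneg (d - c), sq_nonneg (d * c - 1)]]

variable {M : Type*} [TopologicalSpace M] [ChartedSpace ℝ² M]
  {F : PointAffineDistribution (𝓡 2) M} {Q : F.Cost}

/-- In the bracket relation `[V, W] = a V + b W` of a normalized frame, `b` and `a ^ 2` are
invariants of the structure. -/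
theorem IsLocalIsometry.exists_lieBracket_eq {V W V' W' : ℝ² → ℝ²}
    {κ κ' : PartialDiffeomorph (𝓡 2) (𝓡 2) M ℝ² ∞}
    (hκ : F.IsLocalIsometry Q (ofFrame (I := 𝓡 2) V W) (frameCost (I := 𝓡 2) V W fun _ => 1) κ)
    (hκ' : F.IsLocalIsometry Q (ofFrame (I := 𝓡 2) V' W')
      (frameCost (I := 𝓡 2) V' W' fun _ => 1) κ')
    (hV : ContDiffOn ℝ ∞ V κ.target) (hW : ContDiffOn ℝ ∞ W κ.target)
    (hW0 : ∀ y ∈ κ.target, W y ≠ 0)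
    {t : Set ℝ²} (ht : IsOpen t) (htκ : κ'.target ⊆ t)
    (hV' : ContDiffOn ℝ ∞ V' t) (hW' : ContDiffOn ℝ ∞ W' t) (hW0' : ∀ y ∈ t, W' y ≠ 0)
    {m : M} (hm : m ∈ κ.source) (hm' : m ∈ κ'.source) {a b : ℝ}
    (hbr : VectorField.lieBracket ℝ V W (κ m) = a • V (κ m) + b • W (κ m)) :
    ∃ c : ℝ, c ^ 2 = 1 ∧
      VectorField.lieBracket ℝ V' W' (κ' m) = (c * a) • V' (κ' m) + b • W' (κ' m) := by
  set ψ := κ.symm.trans κ'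
  have hinv : κ.symm (κ m) = m := κ.left_inv hm
  have hψm : ψ (κ m) = κ' m := congrArg κ' hinv
  have hmψ : κ m ∈ ψ.source := by
    refine ⟨κ.map_source hm, ?_⟩
    change κ.symm (κ m) ∈ κ'.source
    rwa [hinv]
  have hψs : ψ.source ∈ 𝓝 (κ m) := ψ.open_source.mem_nhds hmψ
  have hψt : ψ (κ m) ∈ t := hψm ▸ htκ (κ'.map_source hm')
  have hψd : ContDiffOn ℝ ∞ ψ ψ.source := contMDiffOn_iff_contDiffOn.1 ψ.contMDiffOn_toFun
  have hψat : ContDiffAt ℝ ∞ ψ (κ m) := hψd.contDiffAt hψs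
  have hκt : κ.target ∈ 𝓝 (κ m) := κ.open_target.mem_nhds (κ.map_source hm)
  have hVat := hV.contDiffAt hκt
  have hWat := hW.contDiffAt hκt
  have hVat' := hV'.contDiffAt (ht.mem_nhds hψt)
  have hWat' := hW'.contDiffAt (ht.mem_nhds hψt)
  have hrel : ∀ y ∈ ψ.source, fderiv ℝ ψ y (V y) = V' (ψ y) ∧
      ∃ c : ℝ, c ^ 2 = 1 ∧ fderiv ℝ ψ y (W y) = c • W' (ψ y) := fun y hy => by
    have hyκ : κ (κ.symm y) = y := κ.right_inv hy.1
    have h := hκ.fderiv_transition hκ' (κ.map_target hy.1) hy.2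
      (hW0 _ (κ.map_source (κ.map_target hy.1))) (hW0' _ (htκ (κ'.map_source hy.2)))
    change fderiv ℝ ψ (κ (κ.symm y)) (V (κ (κ.symm y))) = V' (ψ y) ∧ ∃ c : ℝ, c ^ 2 = 1 ∧
      fderiv ℝ ψ (κ (κ.symm y)) (W (κ (κ.symm y))) = c • W' (ψ y) at h
    rwa [hyκ] at h
  have hψ' : ContDiffAt ℝ ∞ (fderiv ℝ ψ) (κ m) := hψat.fderiv_right (by simp)
  obtain ⟨c, hc, hcW⟩ := exists_eventually_eq_smul_of_sq_eq_one
    (f := fun y => fderiv ℝ ψ y (W y)) (g := fun y => W' (ψ y))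
    (hψ'.continuousAt.clm_apply hWat.continuousAt)
    (hWat'.continuousAt.comp hψat.continuousAt) (hW0' _ hψt)
    (Filter.eventually_of_mem hψs fun y hy => (hrel y hy).2)
  have hbr' := fderiv_lieBracket_of_related (W' := c • W') (contDiffAt_infty.1 hψat 2)
    (hVat.differentiableAt (by simp)) (hWat.differentiableAt (by simp))
    (hVat'.differentiableAt (by simp)) ((hWat'.differentiableAt (by simp)).const_smul c)
    (Filter.eventually_of_mem hψs fun y hy => (hrel y hy).1) hcW
  rw [VectorField.lieBracket_const_smul_right (hWat'.differentiableAt (by simp)), hbr, map_add,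
    map_smul, map_smul, (hrel _ hmψ).1, hcW.self_of_nhds, hψm] at hbr'
  refine ⟨c, hc, ?_⟩
  -- The relation is `a V' + b c W' = c [V', W']`; multiplying by `c` and using `c² = 1` isolates
  -- the bracket and frees `b` of the sign.
  have h := congrArg (fun z => c • z) hbr'
  simp only [smul_add, smul_smul] at h
  rw [← sq, hc, one_smul, mul_comm c (b * c), mul_assoc, ← sq, hc, mul_one] at h
  exact h.symm

variable [IsManifold (𝓡 2) ∞ M]

/-- A homogeneous rank one strictly affine structure on a surface is given, in suitable charts, by
normalized frames with `[V, W] = ± a V + b W` for constants `a` and `b`. -/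
theorem exists_chart_lieBracket_eq (hF : F.IsRankOne) (hstrict : F.IsStrictlyAffine)
    (hQ : F.IsPosDefQuadratic Q) (hhom : F.IsHomogeneous Q) :
    ∃ a b : ℝ, ∀ p : M, ∃ (κ : PartialDiffeomorph (𝓡 2) (𝓡 2) M ℝ² ∞) (V W : ℝ² → ℝ²)
      (s : Set ℝ²) (c : ℝ), p ∈ κ.source ∧ IsOpen s ∧ κ p ∈ s ∧ ContDiffOn ℝ ∞ V s ∧
      ContDiffOn ℝ ∞ W s ∧ (∀ y ∈ s, LinearIndependent ℝ ![V y, W y]) ∧ c ^ 2 = 1 ∧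
      (∀ y ∈ s, VectorField.lieBracket ℝ V W y = (c * a) • V y + b • W y) ∧
      F.IsLocalIsometry Q (ofFrame (I := 𝓡 2) V W) (frameCost (I := 𝓡 2) V W fun _ => 1) κ := by
  rcases isEmpty_or_nonempty M with hM | ⟨⟨p₀⟩⟩
  · exact ⟨0, 0, fun p => (hM.false p).elim⟩
  obtain ⟨κ₀, V₀, W₀, hp₀, hV₀, hW₀, hli₀, hκ₀⟩ := exists_normalized_chart hF hstrict hQ p₀
  obtain ⟨a, b, hab⟩ := exists_smul_add_smul_eq (hli₀ _ (κ₀.map_source hp₀))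
    (VectorField.lieBracket ℝ V₀ W₀ (κ₀ p₀))
  refine ⟨a, b, fun p => ?_⟩
  obtain ⟨κ, V, W, hp, hV, hW, hli, hκ⟩ := exists_normalized_chart hF hstrict hQ p
  have hκp : κ p ∈ κ.target := κ.map_source hp
  have hnhds := κ.open_target.mem_nhds hκp
  have hpt : ∀ y ∈ κ.target, ∃ c : ℝ, c ^ 2 = 1 ∧
      VectorField.lieBracket ℝ V W y = (c * a) • V y + b • W y := fun y hy => by
    -- `κ ∘ φ` is a second normalized chart at `p₀`, with value `y` there, so it can be compared
    -- with `κ₀`.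
    obtain ⟨φ, hpφ, hφ, hφi⟩ := hhom p₀ (κ.symm y)
    have hsrc : p₀ ∈ (φ.trans κ).source := by
      refine ⟨hpφ, ?_⟩
      change φ p₀ ∈ κ.source
      rw [hφ]
      exact κ.map_target hy
    have hval : (φ.trans κ) p₀ = y := (congrArg κ hφ).trans (κ.right_inv hy)
    have h := hκ₀.exists_lieBracket_eq (hφi.trans hκ) hV₀ hW₀ (fun z hz => (hli₀ z hz).ne_zero 1)
      κ.open_target (fun z hz => hz.1) hV hW (fun z hz => (hli z hz).ne_zero 1) hp₀ hsrc hab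
    rwa [hval] at h
  have hVd := hV.contDiffAt hnhds
  have hWd := hW.contDiffAt hnhds
  obtain ⟨c, hc, hev⟩ : ∃ c : ℝ, c ^ 2 = 1 ∧ ∀ᶠ y in 𝓝 (κ p),
      VectorField.lieBracket ℝ V W y = (c * a) • V y + b • W y := by
    -- For `a = 0` any sign will do; otherwise `a V` does not vanish and the sign in `[V, W] - b W =
    -- ± a V` is locally constant.
    rcases eq_or_ne a 0 with rfl | ha
    · refine ⟨1, one_pow 2, Filter.eventually_of_mem hnhds fun y hy => ?_⟩
      obtain ⟨c, -, h⟩ := hpt y hy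
      rw [h, mul_zero, mul_zero]
    · have hV' : ContDiffAt ℝ ∞ (fderiv ℝ V) (κ p) := hVd.fderiv_right (by simp)
      have hW' : ContDiffAt ℝ ∞ (fderiv ℝ W) (κ p) := hWd.fderiv_right (by simp)
      obtain ⟨c, hc, h⟩ := exists_eventually_eq_smul_of_sq_eq_one (x := κ p)
        (f := fun y => fderiv ℝ W y (V y) - fderiv ℝ V y (W y) - b • W y) (g := fun y => a • V y)
        (((hW'.clm_apply hVd).sub (hV'.clm_apply hWd)).sub (hWd.const_smul b)).continuousAt
        (hVd.const_smul a).continuousAt (smul_ne_zero ha ((hli _ hκp).ne_zero 0))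
        (Filter.eventually_of_mem hnhds fun y hy => by
          obtain ⟨c, hc, h⟩ := hpt y hy
          refine ⟨c, hc, ?_⟩
          rw [smul_smul, sub_eq_iff_eq_add]
          exact h)
      refine ⟨c, hc, h.mono fun y hy => ?_⟩
      rw [smul_smul, sub_eq_iff_eq_add] at hy
      exact hy
  obtain ⟨s, hs, hso, hps⟩ := eventually_nhds_iff.1 (hev.and hnhds)
  have hst : s ⊆ κ.target := fun y hy => (hs y hy).2
  exact ⟨κ, V, W, s, c, hp, hso, hps, hV.mono hst, hW.mono hst, fun y hy => hli y (hst hy), hc,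
    fun y hy => (hs y hy).1, hκ⟩

omit [IsManifold (𝓡 2) ∞ M] in
/-- A chart in which the structure is given by a normalized frame, followed by a map that takes the
frame to `v₁, c v₂` with `G c ^ 2 = 1`. -/
theorem IsLocalIsometry.trans_ofFrame {V W : ℝ² → ℝ²} {v₁ v₂ : ℝ² → ℝ²} {G : ℝ² → ℝ}
    {κ : PartialDiffeomorph (𝓡 2) (𝓡 2) M ℝ² ∞}
    (hκ : F.IsLocalIsometry Q (ofFrame (I := 𝓡 2) V W) (frameCost (I := 𝓡 2) V W fun _ => 1) κ)
    {Φ : PartialDiffeomorph (𝓡 2) (𝓡 2) ℝ² ℝ² ∞}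
    (hΦ : ∀ y ∈ Φ.source, W y ≠ 0 ∧ v₂ (Φ y) ≠ 0 ∧ fderiv ℝ Φ y (V y) = v₁ (Φ y) ∧
      ∃ c : ℝ, G (Φ y) * c ^ 2 = 1 ∧ fderiv ℝ Φ y (W y) = c • v₂ (Φ y)) :
    F.IsLocalIsometry Q (ofFrame (I := 𝓡 2) v₁ v₂) (frameCost (I := 𝓡 2) v₁ v₂ G)
      (κ.trans Φ) := by
  refine hκ.trans (isLocalIsometry_ofFrame fun y hy => ?_)
  obtain ⟨hW, hv₂, hV, c, hc, hcW⟩ := hΦ y hy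
  refine ⟨W y, c, ?_, hv₂, rfl, ?_, ?_, fun z u hz => ?_⟩
  · rintro rfl
    norm_num at hc
  · rw [mfderiv_eq_fderiv]
    exact hV
  · rw [mfderiv_eq_fderiv]
    exact hcW
  · rw [frameCost_eq (I := 𝓡 2) V W _ hW z u hz, mul_pow]
    linear_combination (-(1 / 2) * u ^ 2) * hc

end Homogeneous

end PointAffineDistribution

/-! ### The two normal forms -/

theorem theorem2p2 {M : Type*} [TopologicalSpace M]
    [ChartedSpace (EuclideanSpace ℝ (Fin 2)) M] [IsManifold (𝓡 2) ∞ M]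
    (F : PointAffineDistribution (𝓡 2) M) (Q : F.Cost)
    (hF : F.IsRankOne) (hstrict : F.IsStrictlyAffine) (htype : F.IsConstantType)
    (hQ : F.IsPosDefQuadratic Q) (hhom : F.IsHomogeneous Q) :
    (∃ c₁ : ℝ,
      F.IsLocallyEquivalent Q
        (PointAffineDistribution.ofFrame coordField₁ coordField₂)
        (PointAffineDistribution.frameCost coordField₁ coordField₂
          (fun x => Real.exp (2 * c₁ * x 0)))
        Set.univ) ∨
    (∃ j₀ g₀ : ℝ, 0 < g₀ ∧
      F.IsLocallyEquivalent Q
        (PointAffineDistribution.ofFrame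
          (fun x => x 1 • (coordField₁ x + j₀ • coordField₂ x))
          (fun x => x 1 • coordField₂ x))
        (PointAffineDistribution.frameCost
          (fun x => x 1 • (coordField₁ x + j₀ • coordField₂ x))
          (fun x => x 1 • coordField₂ x)
          (fun _ => g₀))
        {x | x 1 ≠ 0}) := by
  obtain ⟨a, b, h⟩ :=
    PointAffineDistribution.exists_chart_lieBracket_eq hF hstrict hQ hhom
  have hcoord₂ : ∀ x, coordField₂ x ≠ 0 := fun x hx => by
    have h1 := congrArg (fun z : EuclideanSpace ℝ (Fin 2) => z 1) hx
    exact one_ne_zero h1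
  rcases eq_or_ne a 0 with rfl | ha
  -- Here `W = exp (b x₁) ∂₂`, so `G exp (2 b x₁) = 1` gives `c₁ = -b`.
  · refine Or.inl ⟨-b, fun p => ?_⟩
    obtain ⟨κ, V, W, s, c, hp, hs, hps, hV, hW, hli, -, hbr, hκ⟩ := h p
    obtain ⟨Φ, hpΦ, hΦ⟩ := exists_coordinates_of_lieBracket_eq_smul (b := b) hs hV hW hli
      (fun y hy => by rw [hbr y hy, mul_zero, zero_smul, zero_add]) hps
    refine ⟨κ.trans Φ, ⟨hp, hpΦ⟩, subset_univ _, hκ.trans_ofFrame fun y hy => ?_⟩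
    obtain ⟨hys, h1, h2⟩ := hΦ y hy
    refine ⟨(hli y hys).ne_zero 1, hcoord₂ _, h1, Real.exp (b * Φ y 0), ?_, ?_⟩
    · rw [← Real.exp_nat_mul, ← Real.exp_add, Real.exp_eq_one_iff]
      push_cast
      ring
    · rw [h2]
      ext i
      fin_cases i <;> simp [coordField₂]
  -- Here `W = -(c a) v₂`, so `g₀ (c a)² = 1`. As `c² = 1`, the value of `g₀` does not depend on the
  -- sign `c`, which may vary with `p`: one model serves all points.
  · refine Or.inr ⟨b, (a ^ 2)⁻¹, by positivity, fun p => ?_⟩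
    obtain ⟨κ, V, W, s, c, hp, hs, hps, hV, hW, hli, hc, hbr, hκ⟩ := h p
    have he₁ : ∀ t j : ℝ, (!₂[t, t * j] : EuclideanSpace ℝ (Fin 2)) =
        t • ((!₂[1, 0] : EuclideanSpace ℝ (Fin 2)) + j • !₂[0, 1]) := fun t j => by
      ext i
      fin_cases i <;> simp
    have he₂ : ∀ d t : ℝ, (!₂[0, d * t] : EuclideanSpace ℝ (Fin 2)) =
        d • t • (!₂[0, 1] : EuclideanSpace ℝ (Fin 2)) := fun d t => by
      ext i
      fin_cases i <;> simp
    have hc0 : c ≠ 0 := by rintro rfl; norm_num at hc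
    obtain ⟨Φ, hpΦ, hΦ⟩ := exists_coordinates_of_lieBracket_eq_add (mul_ne_zero hc0 ha) hs hV hW
      hli hbr hps
    refine ⟨κ.trans Φ, ⟨hp, hpΦ⟩, fun x hx => ?_, hκ.trans_ofFrame fun y hy => ?_⟩
    · have hx' : x ∈ Φ.target := hx.1
      have h1 := (hΦ _ (Φ.map_target hx')).2.1
      have h2 : Φ (Φ.invFun x) = x := Φ.right_inv hx'
      rwa [← h2]
    · obtain ⟨hys, h0, h1, h2⟩ := hΦ y hy
      refine ⟨(hli y hys).ne_zero 1, smul_ne_zero h0 (hcoord₂ _), ?_, -(c * a), ?_, ?_⟩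
      · exact h1.trans (he₁ _ _)
      · rw [neg_sq, mul_pow, hc, one_mul, inv_mul_cancel₀ (pow_ne_zero 2 ha)]
      · exact h2.trans (he₂ _ _)
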